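/- Let $\log$ denote the logarithm to base $2$, and write $[m]=\{1,\dots,m\}$. For $A\subseteq[n]^d$, an $r$-template of $A$ is a function $P$ assigning to each point $x\in A$ a set $P(x)\subseteq[r]$ (its palette). A template $P_1$ is a subtemplate of $P_2$ if $P_1(x)\subseteq P_2(x)$ for every $x\in A$. An $r$-template $P$ of $A$ is a rainbow solution to the $B_{k,h}$-equation if there exist points $x_{\ell,i}\in A$ ($\ell\in[k]$, $i\in[h]$) with $\sum_{i=1}^h x_{1,i}=\sum_{i=1}^h x_{2,i}=\cdots=\sum_{i=1}^h x_{k,i}$ (coordinatewise addition) such that $|P(x_{\ell,i})|=1$ for all $\ell,i$, the palettes $P(x_{\ell,i})$ are pairwise distinct, and $P(x)=\emptyset$ for every other $x\in A$. A template contains no rainbow solutions if none of its subtemplates is a rainbow solution, and $R(P)$ denotes the number of subtemplates of $P$ that are rainbow solutions to the $B_{k,h}$-equation. Theorem. Let $d\ge 1$, $k\ge 2$, $h\ge 2$ and $r\ge kh$ be integers. There is $n_0=n_0(d,k,h,r)$ such that for every $n\ge n_0$ and every $A\subseteq[n]^d$ with $|A|\ge \frac{n^d}{\log n}$ there exists a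 collection $\mathcal{C}$ of $r$-templates of $A$ such that (i) every $r$-template of $A$ that contains no rainbow solutions to the $B_{k,h}$-equation is a subtemplate of some $P\in\mathcal{C}$; (ii) $R(P)\le \frac{1}{(\log n)^{5kh}}|A|^{k(h-1)+1}$ for every $P\in\mathcal{C}$; (iii) $|\mathcal{C}|\le 2^{|A|\,n^{-\frac{k(h-1)}{kh-1}d}(\log n)^{10}}$. -/

import Mathlib

/-- The `d`-dimensional grid `[n]^d`: points all of whose coordinates lie in `{1, …, n}`. -/
def grid (n d : ℕ) : Finset (Fin d → ℕ) :=
  Fintype.piFinset fun _ => Finset.Icc 1 n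

/-- An `r`-template of `A`: it assigns to each point of `A` a palette, i.e. a subset of the
set of `r` colors. -/
abbrev Template {d : ℕ} (r : ℕ) (A : Finset (Fin d → ℕ)) : Type :=
  {x // x ∈ A} → Finset (Fin r)

/-- `P₁` is a subtemplate of `P₂`. -/
def IsSubtemplate {d r : ℕ} {A : Finset (Fin d → ℕ)} (P₁ P₂ : Template r A) : Prop :=
  ∀ x, P₁ x ⊆ P₂ x

/-- The points `x ℓ i` (`k` groups of `h` points of `A`, repetitions allowed) solve the
`B_{k,h}`-equation: all `k` group sums, taken coordinatewise, are equal. -/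
def IsBSolution {d k h : ℕ} {A : Finset (Fin d → ℕ)}
    (x : Fin k → Fin h → {x // x ∈ A}) : Prop :=
  ∀ ℓ ℓ' : Fin k, ∑ i, (x ℓ i : Fin d → ℕ) = ∑ i, (x ℓ' i : Fin d → ℕ)

/-- The template `P` is a rainbow solution to the `B_{k,h}`-equation: there are `k * h` points of
`A` solving the equation whose palettes are singletons and pairwise distinct, and all other
palettes are empty. -/
def IsRainbowSolution {d r : ℕ} {A : Finset (Fin d → ℕ)} (k h : ℕ) (P : Template r A) : Prop :=
  ∃ x : Fin k → Fin h → {x // x ∈ A},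
    IsBSolution x ∧
    (∀ ℓ i, (P (x ℓ i)).card = 1) ∧
    (∀ y, (∀ ℓ i, y ≠ x ℓ i) → P y = ∅) ∧
    Function.Injective (fun p : Fin k × Fin h => P (x p.1 p.2))

/-- The template `P` contains no rainbow solutions to the `B_{k,h}`-equation. -/
def RainbowFree {d r : ℕ} {A : Finset (Fin d → ℕ)} (k h : ℕ) (P : Template r A) : Prop :=
  ¬ ∃ Q : Template r A, IsSubtemplate Q P ∧ IsRainbowSolution k h Q

/-- `R(P)`: the number of subtemplates of `P` that are rainbow solutions to the
`B_{k,h}`-equation. -/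
noncomputable def rainbowCount {d r : ℕ} {A : Finset (Fin d → ℕ)} (k h : ℕ)
    (P : Template r A) : ℕ :=
  {Q : Template r A | IsSubtemplate Q P ∧ IsRainbowSolution k h Q}.ncard

/-!
The rainbow solutions form a `k * h`-uniform hypergraph `rainbowEdges` on the set `V` of pairs
(point of `A`, color): a template is a set of such pairs, a rainbow solution is an edge, and a
template without rainbow solutions is an independent set. The theorem is therefore a hypergraph
container theorem, and there are two things to show: a container lemma that is efficient enough,
and the codegree bounds it asks for.

*Container lemma.* Let `w` be a weighted `i`-uniform hypergraph of total weight `e` and `I` an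
independent set. Links of vertices of `I` are collected in an `(i - 1)`-uniform hypergraph `J`, in
which `I` is again independent; edges of `w` containing a set whose degree in `J` has become too
large are discarded from then on, which keeps the degrees in `J` under control. As long as `J` is
light, few edges are discarded. Let `X` be the set of vertices whose degree in the remaining part
of `w` is at least `e / (4 * |V|)`. Either `I` avoids `X`, which spoils a fixed fraction of `w`, or
some vertex of `I ∩ X` makes `J` substantially heavier. So after `O(τ * |V|)` choices of a vertex
`I` avoids a large set, or `J` has a `τ`-fraction of the weight and the argument goes on with `J`
in place of `w`. At uniformity `0` there are no independent sets. The containers are the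
complements of the sets `X` at the leaves of this tree of choices
(`exists_avoided_family`, `exists_containers`). A container spans at most a fixed fraction of the
edges of the hypergraph, so `O(log n)` rounds leave at most `B` edges
(`exists_containers_iterate`).

*Codegrees.* Prescribing `l` of the points of a solution leaves at most
`k * h - l - k + max 1 (l / h)` points free, because each group not filled by prescribed points has
a point determined by the common sum (`exists_determined_positions`). With
`τ = n ^ (-d * k * (h - 1) / (k * h - 1)) * (log n) ^ (15 / 2)` this is small enough for every
`2 ≤ l ≤ k * h`, and `l = k * h` is the only case in which the powers of `n` cancel
(`codegree_condition`). The number of containers is then at most `2` to the power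
`O(|V| * τ * (log n) ^ 2)`, one logarithm stemming from the number of choices for a vertex and one
from the number of rounds, and a factor `(log n) ^ (1 / 2)` is left for the constants.
-/

open Finset

/-! ### Weighted hypergraphs -/

/-- The weighted degree of `T` in the weighted hypergraph `w`: the total weight of the sets
containing `T`. In particular `wdeg w ∅` is the total weight. -/
def wdeg {V : Type*} [Fintype V] [DecidableEq V] (w : Finset V → ℝ) (T : Finset V) : ℝ :=
  ∑ E with T ⊆ E, w E

/-- `I` contains no edge of the weighted hypergraph `w`, an edge being a set of nonzero weight. -/
def WIndep {V : Type*} (w : Finset V → ℝ) (I : Finset V) : Prop :=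
  ∀ E, E ⊆ I → w E = 0

/-- The link of `v` in `w`: the set `F ∌ v` gets the weight of `insert v F`. -/
def wlink {V : Type*} [DecidableEq V] (w : Finset V → ℝ) (v : V) (F : Finset V) : ℝ :=
  if v ∈ F then 0 else w (insert v F)

section Weighted

variable {V : Type*} [Fintype V] [DecidableEq V]

lemma wdeg_empty (w : Finset V → ℝ) : wdeg w ∅ = ∑ E, w E := by
  simp [wdeg]

lemma wdeg_nonneg {w : Finset V → ℝ} (hw : ∀ E, 0 ≤ w E) (T : Finset V) : 0 ≤ wdeg w T :=
  sum_nonneg fun E _ => hw E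

lemma wdeg_mono {w w' : Finset V → ℝ} (hw : ∀ E, w E ≤ w' E) (T : Finset V) :
    wdeg w T ≤ wdeg w' T :=
  sum_le_sum fun E _ => hw E

lemma wdeg_add (w w' : Finset V → ℝ) (T : Finset V) :
    wdeg (fun E => w E + w' E) T = wdeg w T + wdeg w' T :=
  sum_add_distrib

lemma wdeg_wlink (w : Finset V → ℝ) (v : V) (T : Finset V) :
    wdeg (wlink w v) T = if v ∈ T then 0 else wdeg w (insert v T) := by
  split_ifs with hv
  · refine sum_eq_zero fun F hF => ?_
    rw [wlink, if_pos ((mem_filter.1 hF).2 hv)]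
  · have h1 : wdeg (wlink w v) T = ∑ F with T ⊆ F ∧ v ∉ F, w (insert v F) := by
      rw [wdeg, ← filter_filter, sum_filter (p := fun F => v ∉ F)]
      refine sum_congr rfl fun F _ => ?_
      by_cases h : v ∈ F <;> simp [wlink, h]
    rw [h1, wdeg]
    refine sum_bij' (fun F _ => insert v F) (fun E _ => E.erase v) ?_ ?_ ?_ ?_ ?_
    · intro F hF
      simp only [mem_filter, mem_univ, true_and] at hF ⊢
      exact insert_subset_insert v hF.1
    · intro E hE
      simp only [mem_filter, mem_univ, true_and] at hE ⊢
      refine ⟨fun x hx => mem_erase.2 ⟨?_, hE (mem_insert_of_mem hx)⟩, notMem_erase v E⟩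
      rintro rfl
      exact hv hx
    · intro F hF
      simp only [mem_filter, mem_univ, true_and] at hF
      exact erase_insert hF.2
    · intro E hE
      simp only [mem_filter, mem_univ, true_and] at hE
      exact insert_erase (hE (mem_insert_self v T))
    · intro F _
      rfl

/-- Every edge of size `i` has `2 ^ i` subsets, so the degrees of all sets sum to `2 ^ i` times
the total weight. -/
lemma sum_wdeg {w : Finset V → ℝ} {i : ℕ} (hs : ∀ E, w E ≠ 0 → E.card = i) :
    ∑ T, wdeg w T = 2 ^ i * wdeg w ∅ := by
  simp only [wdeg, sum_filter]
  rw [sum_comm, mul_sum]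
  refine sum_congr rfl fun E _ => ?_
  rw [← sum_filter, sum_const, nsmul_eq_mul, filter_subset_univ, card_powerset,
    if_pos (empty_subset E)]
  by_cases h : w E = 0
  · simp [h]
  · rw [hs E h]; push_cast; ring

lemma sum_wdeg_singleton {w : Finset V → ℝ} {i : ℕ} (hs : ∀ E, w E ≠ 0 → E.card = i) :
    ∑ u, wdeg w {u} = i * wdeg w ∅ := by
  simp only [wdeg, sum_filter]
  rw [sum_comm, mul_sum]
  refine sum_congr rfl fun E _ => ?_
  simp only [singleton_subset_iff]
  rw [← sum_filter, sum_const, nsmul_eq_mul, filter_mem_eq_inter, univ_inter,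
    if_pos (empty_subset E)]
  by_cases h : w E = 0
  · simp [h]
  · rw [hs E h]

open Classical in
/-- The part of `w` on edges containing no nonempty set `T` that is saturated in `J`, that is,
whose degree in `J` has reached the threshold `c T`. -/
noncomputable def unsaturated (w J : Finset V → ℝ) (c : Finset V → ℝ) (E : Finset V) : ℝ :=
  if ∃ T ⊆ E, T.Nonempty ∧ c T ≤ wdeg J T then 0 else w E

lemma unsaturated_nonneg {w : Finset V → ℝ} (hw : ∀ E, 0 ≤ w E) (J c : Finset V → ℝ)
    (E : Finset V) : 0 ≤ unsaturated w J c E := by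
  rw [unsaturated]; split_ifs
  exacts [le_rfl, hw E]

lemma unsaturated_le {w : Finset V → ℝ} (hw : ∀ E, 0 ≤ w E) (J c : Finset V → ℝ)
    (E : Finset V) : unsaturated w J c E ≤ w E := by
  rw [unsaturated]; split_ifs
  exacts [hw E, le_rfl]

lemma ne_zero_of_unsaturated_ne_zero {w J c : Finset V → ℝ} {E : Finset V}
    (h : unsaturated w J c E ≠ 0) : w E ≠ 0 := by
  rw [unsaturated] at h; split_ifs at h
  · exact absurd rfl h
  · exact h

lemma wdeg_unsaturated_eq_zero (w : Finset V → ℝ) {J c : Finset V → ℝ} {T S : Finset V}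
    (hT : T.Nonempty) (hsat : c T ≤ wdeg J T) (hTS : T ⊆ S) :
    wdeg (unsaturated w J c) S = 0 := by
  refine sum_eq_zero fun E hE => ?_
  rw [unsaturated, if_pos]
  exact ⟨T, hTS.trans (mem_filter.1 hE).2, hT, hsat⟩

/-- Saturated sets destroy little weight as long as `J` is light: a saturated `T` has
`wdeg w T ≤ τ⁻¹ * wdeg J T`, and the degrees in `J` sum to at most `2 ^ i` times its weight. -/
lemma total_le_unsaturated_add {w J c : Finset V → ℝ} {τ : ℝ} {i : ℕ} (hτ : 0 < τ)
    (hw : ∀ E, 0 ≤ w E) (hJ : ∀ E, 0 ≤ J E) (hJs : ∀ E, J E ≠ 0 → E.card = i)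
    (hdeg : ∀ T : Finset V, T.Nonempty → τ * wdeg w T ≤ c T) :
    wdeg w ∅ ≤ wdeg (unsaturated w J c) ∅ + τ⁻¹ * (2 ^ i * wdeg J ∅) := by
  classical
  rw [← sum_wdeg hJs]
  have h1 : wdeg w ∅ - wdeg (unsaturated w J c) ∅ ≤
      ∑ T with T.Nonempty ∧ c T ≤ wdeg J T, wdeg w T := by
    rw [wdeg_empty, wdeg_empty, ← sum_sub_distrib]
    have hcomm : ∑ T with T.Nonempty ∧ c T ≤ wdeg J T, wdeg w T =
        ∑ E, ∑ T with T.Nonempty ∧ c T ≤ wdeg J T, if T ⊆ E then w E else 0 := by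
      rw [sum_comm]
      exact sum_congr rfl fun T _ => sum_filter _ _
    rw [hcomm]
    refine sum_le_sum fun E _ => ?_
    rw [unsaturated]
    split_ifs with h
    · obtain ⟨T, hTE, hT⟩ := h
      have := single_le_sum (f := fun T => if T ⊆ E then w E else 0)
        (s := ({T | T.Nonempty ∧ c T ≤ wdeg J T} : Finset (Finset V)))
        (fun S _ => by split_ifs; exacts [hw E, le_rfl])
        (mem_filter.2 ⟨mem_univ T, hT⟩)
      simpa [hTE, wdeg] using this
    · rw [sub_self]
      exact sum_nonneg fun S _ => by split_ifs; exacts [hw E, le_rfl]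
  have h2 : ∑ T with T.Nonempty ∧ c T ≤ wdeg J T, wdeg w T ≤ τ⁻¹ * ∑ T, wdeg J T := by
    rw [mul_sum]
    refine (sum_le_sum fun T hT => ?_).trans
      (sum_le_sum_of_subset_of_nonneg (filter_subset _ _) fun T _ _ =>
        mul_nonneg (inv_nonneg.2 hτ.le) (wdeg_nonneg hJ T))
    obtain ⟨-, hne, hsat⟩ := mem_filter.1 hT
    rw [le_inv_mul_iff₀ hτ]
    exact (hdeg T hne).trans hsat
  linarith

/-- Adding to `J` the link of a vertex in the unsaturated part of `w` keeps all degrees below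
twice the saturation threshold. -/
lemma wdeg_add_wlink_le {w J M : Finset V → ℝ} {τ lam : ℝ} (hlam : 0 ≤ lam) (hw : ∀ E, 0 ≤ w E)
    (hM : ∀ (T : Finset V) v, T.Nonempty → v ∉ T → M (insert v T) ≤ τ * M T)
    (hdeg : ∀ T : Finset V, T.Nonempty → wdeg w T ≤ lam * M T)
    (hJdeg : ∀ T : Finset V, T.Nonempty → wdeg J T ≤ 2 * τ * lam * M T)
    (v : V) (T : Finset V) (hT : T.Nonempty) :
    wdeg (fun F => J F + wlink (unsaturated w J fun S => τ * lam * M S) v F) T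
      ≤ 2 * τ * lam * M T := by
  rw [wdeg_add, wdeg_wlink]
  split_ifs with hv
  · simpa using hJdeg T hT
  by_cases hsat : τ * lam * M T ≤ wdeg J T
  · rw [wdeg_unsaturated_eq_zero w (c := fun S => τ * lam * M S) hT hsat (subset_insert v T)]
    simpa using hJdeg T hT
  · have h1 := wdeg_mono (unsaturated_le hw J fun S => τ * lam * M S) (insert v T)
    have h2 := hdeg (insert v T) (insert_nonempty v T)
    have h3 := mul_le_mul_of_nonneg_left (hM T v hT hv) hlam
    linarith

end Weighted

/-! ### The weighted container lemma -/

section Containers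

variable {V : Type*} [Fintype V] [DecidableEq V]

/-- One level of the recursion, from uniformity `i + 1` to uniformity `i`. The weighted hypergraph
`J` collects links in `w` of vertices of the independent set `I`, so that `I` stays independent
in `J`. As long as `J` is light, either `I` avoids the set `X` of all vertices of degree at least
`wdeg w ∅ / (4 * |V|)` in the unsaturated part of `w`, or the link of one of the at most `|V|`
vertices `v ∈ X ∩ I` is added to `J`. Once `J` is heavy enough, `hrec` takes over. The number `t` bounds
the number of links still to be added. -/
lemma exists_avoided_family_of_link {i D : ℕ} {w M : Finset V → ℝ} {τ lam γ : ℝ}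
    (hτ : 0 < τ) (hlam : 0 < lam)
    (hM : ∀ (T : Finset V) v, T.Nonempty → v ∉ T → M (insert v T) ≤ τ * M T)
    (hw : ∀ E, 0 ≤ w E) (hws : ∀ E, w E ≠ 0 → E.card = i + 1)
    (hdeg : ∀ T : Finset V, T.Nonempty → wdeg w T ≤ lam * M T)
    (htot : 0 < wdeg w ∅) (hγ : γ ≤ 1 / 4)
    (hrec : ∀ J : Finset V → ℝ, (∀ E, 0 ≤ J E) → (∀ E, J E ≠ 0 → E.card = i) →
      (∀ T : Finset V, T.Nonempty → wdeg J T ≤ 2 * τ * lam * M T) →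
      τ * wdeg w ∅ ≤ 2 ^ (i + 1) * wdeg J ∅ →
      ∃ F : Finset (Finset V), F.card ≤ (Fintype.card V + 1) ^ D ∧
        (∀ X ∈ F, γ * wdeg w ∅ ≤ lam * ∑ u ∈ X, M {u}) ∧
        ∀ I, WIndep J I → ∃ X ∈ F, Disjoint X I)
    (t : ℕ) (J : Finset V → ℝ) (hJ : ∀ E, 0 ≤ J E) (hJs : ∀ E, J E ≠ 0 → E.card = i)
    (hJdeg : ∀ T : Finset V, T.Nonempty → wdeg J T ≤ 2 * τ * lam * M T)
    (ht : τ * wdeg w ∅ ≤ wdeg J ∅ + t * (wdeg w ∅ / (4 * Fintype.card V))) :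
    ∃ F : Finset (Finset V), F.card ≤ (Fintype.card V + 1) ^ (D + t) ∧
      (∀ X ∈ F, γ * wdeg w ∅ ≤ lam * ∑ u ∈ X, M {u}) ∧
      ∀ I, WIndep w I → WIndep J I → ∃ X ∈ F, Disjoint X I := by
  induction t generalizing J with
  | zero =>
    obtain ⟨F, h1, h2, h3⟩ := hrec J hJ hJs hJdeg (by
      have h0 := wdeg_nonneg hJ ∅
      have h1 : (1 : ℝ) ≤ 2 ^ (i + 1) := one_le_pow₀ one_le_two
      simp only [Nat.cast_zero, zero_mul, add_zero] at ht
      nlinarith)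
    exact ⟨F, h1, h2, fun I _ hI => h3 I hI⟩
  | succ t ih =>
    by_cases hheavy : τ * wdeg w ∅ ≤ 2 ^ (i + 1) * wdeg J ∅
    · obtain ⟨F, h1, h2, h3⟩ := hrec J hJ hJs hJdeg hheavy
      exact ⟨F, h1.trans (Nat.pow_le_pow_right (Nat.succ_pos _) (Nat.le_add_right _ _)), h2,
        fun I _ hI => h3 I hI⟩
    push Not at hheavy
    set cur := unsaturated w J fun S => τ * lam * M S with hcur
    have hcur0 : ∀ E, 0 ≤ cur E := unsaturated_nonneg hw _ _
    have hcurs : ∀ E, cur E ≠ 0 → E.card = i + 1 := fun E hE =>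
      hws E (ne_zero_of_unsaturated_ne_zero hE)
    have hhalf : wdeg w ∅ / 2 ≤ wdeg cur ∅ := by
      have h1 := total_le_unsaturated_add (c := fun S => τ * lam * M S) hτ hw hJ hJs
        (fun T hT => by
          have := mul_le_mul_of_nonneg_left (hdeg T hT) hτ.le
          simpa [mul_assoc] using this)
      have h2 : τ⁻¹ * (2 ^ i * wdeg J ∅) ≤ wdeg w ∅ / 2 := by
        rw [inv_mul_le_iff₀ hτ]
        rw [pow_succ] at hheavy
        linarith
      linarith
    set e := wdeg w ∅ with he
    set N : ℝ := ((Fintype.card V : ℕ) : ℝ) with hN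
    have hNpos : 0 < N := by
      rw [hN, Nat.cast_pos, Fintype.card_pos_iff]
      by_contra hV
      rw [not_nonempty_iff] at hV
      have h1 : e = w ∅ := by
        rw [he, wdeg_empty]
        exact Fintype.sum_unique _ |>.trans (congrArg w (Subsingleton.elim _ _))
      have h2 := hws ∅ (by rw [← h1]; exact htot.ne')
      simp at h2
    classical
    set X : Finset V := {u | e / (4 * N) ≤ wdeg cur {u}} with hX
    have hXM : γ * e ≤ lam * ∑ u ∈ X, M {u} := by
      have h1 := sum_wdeg_singleton hcurs
      rw [← sum_filter_add_sum_filter_not univ (fun u => e / (4 * N) ≤ wdeg cur {u})] at h1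
      have h2 : ∑ u with ¬ e / (4 * N) ≤ wdeg cur {u}, wdeg cur {u} ≤ e / 4 := by
        have h3 : ∑ u with ¬ e / (4 * N) ≤ wdeg cur {u}, wdeg cur {u} ≤
            ∑ u : V, e / (4 * N) :=
          (sum_le_sum fun u hu => (not_le.1 (mem_filter.1 hu).2).le).trans
            (sum_le_sum_of_subset_of_nonneg (filter_subset _ _) fun _ _ _ => by positivity)
        refine h3.trans (le_of_eq ?_)
        rw [sum_const, card_univ, nsmul_eq_mul, ← hN]
        field_simp
      have h4 : wdeg cur ∅ ≤ ((i + 1 : ℕ) : ℝ) * wdeg cur ∅ := by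
        have := wdeg_nonneg hcur0 ∅
        push_cast
        nlinarith [(Nat.cast_nonneg i : (0 : ℝ) ≤ i)]
      have h5 : ∑ u ∈ X, wdeg cur {u} ≤ lam * ∑ u ∈ X, M {u} := by
        rw [mul_sum]
        exact sum_le_sum fun u _ => (wdeg_mono (unsaturated_le hw _ _) {u}).trans
          (hdeg {u} (singleton_nonempty u))
      have h6 : γ * e ≤ 1 / 4 * e := mul_le_mul_of_nonneg_right hγ htot.le
      rw [← hX] at h1
      linarith
    have hbranch : ∀ v ∈ X, ∃ F : Finset (Finset V),
        F.card ≤ (Fintype.card V + 1) ^ (D + t) ∧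
        (∀ X ∈ F, γ * e ≤ lam * ∑ u ∈ X, M {u}) ∧
        ∀ I, WIndep w I → WIndep (fun F => J F + wlink cur v F) I → ∃ X ∈ F, Disjoint X I := by
      intro v hv
      have hv' : e / (4 * N) ≤ wdeg cur {v} := (mem_filter.1 hv).2
      have hl0 : ∀ F, 0 ≤ wlink cur v F := fun F => by
        rw [wlink]; split_ifs
        exacts [le_rfl, hcur0 _]
      refine ih _ (fun E => add_nonneg (hJ E) (hl0 E)) (fun E hE => ?_)
        (wdeg_add_wlink_le hlam.le hw hM hdeg hJdeg v) ?_
      · by_cases h : J E = 0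
        · rw [h, zero_add, wlink] at hE
          split_ifs at hE with hvE
          · exact absurd rfl hE
          · have := hcurs _ hE
            rw [card_insert_of_notMem hvE] at this
            omega
        · exact hJs E h
      · rw [wdeg_add, wdeg_wlink, if_neg (notMem_empty v), insert_empty_eq]
        push_cast at ht
        linarith
    choose! G hG1 hG2 hG3 using hbranch
    refine ⟨insert X (X.biUnion G), ?_, ?_, ?_⟩
    · have h1 : (X.biUnion G).card ≤ Fintype.card V * (Fintype.card V + 1) ^ (D + t) :=
        (card_biUnion_le_card_mul _ _ _ hG1).trans
          (Nat.mul_le_mul_right _ (card_le_univ X))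
      calc (insert X (X.biUnion G)).card
          ≤ Fintype.card V * (Fintype.card V + 1) ^ (D + t) + 1 :=
            (card_insert_le _ _).trans (Nat.add_le_add_right h1 1)
        _ ≤ Fintype.card V * (Fintype.card V + 1) ^ (D + t) + (Fintype.card V + 1) ^ (D + t) :=
            Nat.add_le_add_left (Nat.one_le_pow _ _ (Nat.succ_pos _)) _
        _ = (Fintype.card V + 1) ^ (D + (t + 1)) := by ring
    · intro Y hY
      rcases mem_insert.1 hY with rfl | hY
      · exact hXM
      · obtain ⟨v, hv, hYv⟩ := mem_biUnion.1 hY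
        exact hG2 v hv Y hYv
    · intro I hI hJI
      by_cases hXI : Disjoint X I
      · exact ⟨X, mem_insert_self _ _, hXI⟩
      · obtain ⟨v, hv, hvI⟩ := not_disjoint_iff.1 hXI
        obtain ⟨Y, hY, hYI⟩ := hG3 v hv I hI (fun E hE => by
          have h1 := hI (insert v E) (insert_subset hvI hE)
          have h2 : cur (insert v E) = 0 :=
            le_antisymm ((unsaturated_le hw _ _ _).trans_eq h1) (hcur0 _)
          simp [hJI E hE, wlink, h2])
        exact ⟨Y, mem_insert_of_mem (mem_biUnion.2 ⟨v, hv, hY⟩), hYI⟩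

/-- The weighted container lemma. If `M` bounds the degrees of `w` and drops by a factor `τ`
with each vertex added to the set, then at most `i * m` steps, each with at most `|V| + 1` outcomes,
find for each independent set a set `X` it avoids that has large total `M`-weight. -/
theorem exists_avoided_family {M : Finset V → ℝ} {τ : ℝ} {m : ℕ} (hτ : 0 < τ) (hM0 : ∀ T, 0 ≤ M T)
    (hM : ∀ (T : Finset V) v, T.Nonempty → v ∉ T → M (insert v T) ≤ τ * M T)
    (hm : 4 * Fintype.card V * τ ≤ m) (i : ℕ) (w : Finset V → ℝ) (lam : ℝ) (hlam : 0 < lam)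
    (hw : ∀ E, 0 ≤ w E) (hws : ∀ E, w E ≠ 0 → E.card = i)
    (hdeg : ∀ T : Finset V, T.Nonempty → wdeg w T ≤ lam * M T) (htot : 0 < wdeg w ∅) :
    ∃ F : Finset (Finset V), F.card ≤ (Fintype.card V + 1) ^ (i * m) ∧
      (∀ X ∈ F, (1 / 2) ^ (i + 1) ^ 2 * wdeg w ∅ ≤ lam * ∑ u ∈ X, M {u}) ∧
      ∀ I, WIndep w I → ∃ X ∈ F, Disjoint X I := by
  induction i generalizing w lam with
  | zero =>
    -- All weight sits on `∅`, which is contained in every `I`: no set is independent.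
    refine ⟨∅, by simp, by simp, fun I hI => ?_⟩
    rw [wdeg_empty, Fintype.sum_eq_single ∅ fun E hE => ?_, hI ∅ (empty_subset I)] at htot
    · exact absurd htot (lt_irrefl 0)
    · by_contra h
      exact hE (card_eq_zero.1 (hws E h))
  | succ i ih =>
    have hγ : (1 / 2 : ℝ) ^ (i + 1 + 1) ^ 2 ≤ 1 / 4 := by
      calc (1 / 2 : ℝ) ^ (i + 1 + 1) ^ 2 ≤ (1 / 2) ^ 2 :=
            pow_le_pow_of_le_one (by norm_num) (by norm_num)
              ((by norm_num : 2 ≤ 2 ^ 2).trans (Nat.pow_le_pow_left (by omega) 2))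
        _ = 1 / 4 := by norm_num
    have hwz : ∀ T, wdeg (fun _ : Finset V => (0 : ℝ)) T = 0 := fun T => by simp [wdeg]
    obtain ⟨F, h1, h2, h3⟩ := exists_avoided_family_of_link (i := i) (D := i * m)
      hτ hlam hM hw hws hdeg htot hγ
      (fun J hJ hJs hJdeg hheavy => by
        have hJtot : 0 < wdeg J ∅ := by
          have h1 : 0 < 2 ^ (i + 1) * wdeg J ∅ := (mul_pos hτ htot).trans_le hheavy
          exact pos_of_mul_pos_right h1 (by positivity)
        obtain ⟨F, h1, h2, h3⟩ := ih J (2 * τ * lam) (by positivity) hJ hJs hJdeg hJtot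
        refine ⟨F, h1, fun X hX => ?_, h3⟩
        have h4 := h2 X hX
        -- `(i + 2) ^ 2 = (i + 1) ^ 2 + (i + 1) + (i + 2)`.
        have h5 : (1 / 2 : ℝ) ^ (i + 1 + 1) ^ 2 * 2 ^ (i + 1) * 2 ≤ (1 / 2) ^ (i + 1) ^ 2 := by
          have h6 : (i + 1 + 1) ^ 2 = (i + 1) ^ 2 + (i + 1) + 1 + (i + 1) := by ring
          rw [h6, pow_add, pow_add, pow_add, pow_one]
          have h7 : (1 / 2 : ℝ) ^ (i + 1) * 2 ^ (i + 1) = 1 := by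
            rw [← mul_pow]; norm_num
          have h8 : (1 / 2 : ℝ) ^ (i + 1) ≤ 1 := pow_le_one₀ (by norm_num) (by norm_num)
          have h9 : (0 : ℝ) < (1 / 2) ^ (i + 1) ^ 2 := by positivity
          calc (1 / 2 : ℝ) ^ (i + 1) ^ 2 * (1 / 2) ^ (i + 1) * (1 / 2) * (1 / 2) ^ (i + 1) *
                2 ^ (i + 1) * 2
              = (1 / 2 : ℝ) ^ (i + 1) ^ 2 * (1 / 2) ^ (i + 1) *
                ((1 / 2 : ℝ) ^ (i + 1) * 2 ^ (i + 1)) := by ring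
            _ ≤ (1 / 2) ^ (i + 1) ^ 2 := by rw [h7, mul_one]; nlinarith
        set g : ℝ := (1 / 2) ^ (i + 1 + 1) ^ 2
        have hg : 0 ≤ g := by positivity
        have h6 : τ * (2 * (g * wdeg w ∅)) ≤ τ * (2 * (lam * ∑ u ∈ X, M {u})) := by
          calc τ * (2 * (g * wdeg w ∅)) = 2 * g * (τ * wdeg w ∅) := by ring
            _ ≤ 2 * g * (2 ^ (i + 1) * wdeg J ∅) :=
              mul_le_mul_of_nonneg_left hheavy (by positivity)
            _ = g * 2 ^ (i + 1) * 2 * wdeg J ∅ := by ring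
            _ ≤ (1 / 2) ^ (i + 1) ^ 2 * wdeg J ∅ := mul_le_mul_of_nonneg_right h5 hJtot.le
            _ ≤ 2 * τ * lam * ∑ u ∈ X, M {u} := h4
            _ = τ * (2 * (lam * ∑ u ∈ X, M {u})) := by ring
        have h7 := le_of_mul_le_mul_left h6 hτ
        linarith)
      m (fun _ => 0) (fun _ => le_rfl) (fun _ h => absurd rfl h)
      (fun T _ => by rw [hwz]; have := hM0 T; positivity) (by
        rw [hwz, zero_add]
        rcases Nat.eq_zero_or_pos (Fintype.card V) with h0 | hpos
        · exfalso
          have : IsEmpty V := Fintype.card_eq_zero_iff.1 h0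
          refine htot.ne' ?_
          rw [wdeg_empty]
          refine sum_eq_zero fun E _ => ?_
          by_contra hE
          have h2 := hws E hE
          rw [Subsingleton.elim E ∅, card_empty] at h2
          omega
        · have hN : (0 : ℝ) < Fintype.card V := Nat.cast_pos.2 hpos
          rw [mul_div_assoc', le_div_iff₀ (by positivity)]
          nlinarith)
    refine ⟨F, h1.trans_eq (by ring), h2, fun I hI => h3 I hI fun _ _ => rfl⟩

end Containers

/-! ### Containers for uniform hypergraphs -/

section Iteration

variable {V : Type*} [Fintype V] [DecidableEq V]

lemma wdeg_indicator (H : Finset (Finset V)) (T : Finset V) :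
    wdeg (fun E => if E ∈ H then (1 : ℝ) else 0) T = ({E ∈ H | T ⊆ E} : Finset _).card := by
  rw [wdeg, sum_boole]
  congr 2
  ext E
  simp [and_comm]

/-- The constant in the codegree condition for `s`-uniform hypergraphs: half of the constant in
`exists_avoided_family`, so that the codegree terms account for at most half of the `M`-weight of
an avoided set. -/
noncomputable def codegreeConst (s : ℕ) : ℝ := (1 / 2) ^ (s + 1) ^ 2 / 2

lemma codegreeConst_pos (s : ℕ) : 0 < codegreeConst s := by
  rw [codegreeConst]; positivity

lemma codegreeConst_le (s : ℕ) : codegreeConst s ≤ 1 / 2 := by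
  have : (1 / 2 : ℝ) ^ (s + 1) ^ 2 ≤ 1 := pow_le_one₀ (by norm_num) (by norm_num)
  rw [codegreeConst]
  linarith

/-- A single application of the container lemma: the containers of the independent sets of an
`s`-uniform hypergraph `H` span at most a fixed fraction of its edges. No bound on the degrees of
vertices is needed, because the lemma bounds from below the sum over `X` of the degrees. -/
theorem exists_containers {H : Finset (Finset V)} {s m : ℕ} {τ : ℝ} (hτ : 0 < τ) (hs : 1 ≤ s)
    (hH : ∀ E ∈ H, E.card = s) (hne : H.Nonempty) (hm : 4 * Fintype.card V * τ ≤ m)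
    (hcodeg : ∀ T : Finset V, 2 ≤ T.card → (({E ∈ H | T ⊆ E} : Finset _).card : ℝ) ≤
      codegreeConst s * τ ^ (T.card - 1) * (H.card / Fintype.card V)) :
    ∃ F : Finset (Finset V), F.card ≤ (Fintype.card V + 1) ^ (s * m) ∧
      (∀ C ∈ F, (({E ∈ H | E ⊆ C} : Finset _).card : ℝ) ≤ (1 - codegreeConst s / s) * H.card) ∧
      ∀ I : Finset V, (∀ E ∈ H, ¬ E ⊆ I) → ∃ C ∈ F, I ⊆ C := by
  set K := codegreeConst s with hK
  have hK0 : 0 < K := codegreeConst_pos s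
  set N : ℝ := ((Fintype.card V : ℕ) : ℝ) with hN
  set e : ℝ := (H.card : ℝ) with he
  have he0 : 0 < e := Nat.cast_pos.2 hne.card_pos
  have hNpos : 0 < N := by
    obtain ⟨E, hE⟩ := hne
    have h1 := card_le_univ E
    rw [hH E hE] at h1
    exact Nat.cast_pos.2 (hs.trans h1)
  set deg : Finset V → ℝ := fun T => (({E ∈ H | T ⊆ E} : Finset _).card : ℝ) with hdeg
  -- For single vertices `M` is the degree plus a term too small to matter, and for larger sets it
  -- is the assumed codegree bound.
  set M : Finset V → ℝ := fun T =>
    (if T.card = 1 then deg T else 0) + K * τ ^ (T.card - 1) * (e / N) with hM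
  have hM0 : ∀ T, 0 ≤ M T := fun T => by
    have : 0 ≤ deg T := Nat.cast_nonneg _
    simp only [hM]; split_ifs <;> positivity
  obtain ⟨F, h1, h2, h3⟩ := exists_avoided_family (M := M) hτ hM0
    (fun T v hT hv => by
      have hc : 1 ≤ T.card := hT.card_pos
      have h0 : 0 ≤ deg T := Nat.cast_nonneg _
      have h1 : τ * (K * τ ^ (T.card - 1) * (e / N)) ≤ τ * M T := by
        refine mul_le_mul_of_nonneg_left ?_ hτ.le
        simp only [hM]; split_ifs <;> linarith
      refine le_trans (le_of_eq ?_) h1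
      simp only [hM]
      rw [card_insert_of_notMem hv, if_neg (by omega), Nat.add_sub_cancel]
      obtain ⟨c, hc'⟩ := Nat.exists_eq_add_of_le' hc
      rw [hc', Nat.add_sub_cancel, pow_succ]
      ring)
    hm s (fun E => if E ∈ H then 1 else 0) 1 one_pos
    (fun E => by split_ifs <;> norm_num)
    (fun E hE => by
      by_contra h
      exact hE (if_neg fun h' => h (hH E h')))
    (fun T hT => by
      rw [wdeg_indicator, one_mul]
      simp only [hM]
      have h4 : 0 ≤ K * τ ^ (T.card - 1) * (e / N) := by positivity
      split_ifs with h
      · linarith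
      · rw [zero_add]
        have := hT.card_pos
        exact hcodeg T (by omega))
    (by rw [wdeg_indicator]; simpa using hne.card_pos)
  refine ⟨F.image fun X => Xᶜ, card_image_le.trans h1, ?_, ?_⟩
  · intro C hC
    obtain ⟨X, hX, rfl⟩ := mem_image.1 hC
    have h4 := h2 X hX
    rw [wdeg_indicator, one_mul] at h4
    simp only [empty_subset, filter_true] at h4
    have h5 : ∑ u ∈ X, M {u} ≤ ∑ u ∈ X, deg {u} + K * e := by
      have h6 : ∀ u ∈ X, M {u} = deg {u} + K * (e / N) := fun u _ => by simp [hM]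
      rw [sum_congr rfl h6, sum_add_distrib, sum_const, nsmul_eq_mul]
      have h7 : (X.card : ℝ) ≤ N := Nat.cast_le.2 (card_le_univ X)
      have h8 : (X.card : ℝ) * (K * (e / N)) ≤ N * (K * (e / N)) :=
        mul_le_mul_of_nonneg_right h7 (by positivity)
      have h9 : N * (K * (e / N)) = K * e := by field_simp
      linarith
    -- An edge meeting `X` is counted at most `s` times in the sum of the degrees over `X`.
    have h6 : ∑ u ∈ X, deg {u} ≤ s * ((({E ∈ H | ¬ E ⊆ Xᶜ} : Finset _).card : ℕ) : ℝ) := by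
      have h7 : ∑ u ∈ X, deg {u} = ∑ E ∈ H, ((X ∩ E).card : ℝ) := by
        simp only [hdeg, singleton_subset_iff, card_filter, Nat.cast_sum]
        rw [sum_comm]
        refine sum_congr rfl fun E _ => ?_
        rw [← filter_mem_eq_inter, card_filter, Nat.cast_sum]
      rw [h7, ← sum_filter_add_sum_filter_not H (fun E => E ⊆ Xᶜ)]
      have h8 : ∑ E ∈ H with E ⊆ Xᶜ, ((X ∩ E).card : ℝ) = 0 := by
        refine sum_eq_zero fun E hE => ?_
        have := (mem_filter.1 hE).2
        rw [subset_compl_iff_disjoint_left] at this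
        simp [disjoint_iff_inter_eq_empty.1 this]
      rw [h8, zero_add, mul_comm, ← nsmul_eq_mul]
      refine sum_le_card_nsmul _ _ _ fun E hE => ?_
      rw [← hH E (mem_filter.1 hE).1]
      exact Nat.cast_le.2 (card_le_card inter_subset_right)
    have h7 : (({E ∈ H | E ⊆ Xᶜ} : Finset _).card : ℝ) +
        (({E ∈ H | ¬ E ⊆ Xᶜ} : Finset _).card : ℝ) = e := by
      rw [he, ← card_filter_add_card_filter_not (s := H) (fun E => E ⊆ Xᶜ)]
      push_cast; ring
    have h8 : K * e ≤ s * (({E ∈ H | ¬ E ⊆ Xᶜ} : Finset _).card : ℝ) := by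
      have : (1 / 2 : ℝ) ^ (s + 1) ^ 2 = 2 * K := by rw [hK, codegreeConst]; ring
      rw [this] at h4
      linarith
    have hs0 : (0 : ℝ) < s := Nat.cast_pos.2 hs
    have h9 : K / s * e ≤ (({E ∈ H | ¬ E ⊆ Xᶜ} : Finset _).card : ℝ) := by
      rw [div_mul_eq_mul_div, div_le_iff₀ hs0]
      linarith
    linarith
  · intro I hI
    obtain ⟨X, hX, hXI⟩ := h3 I fun E hE => if_neg fun h => hI E h hE
    exact ⟨Xᶜ, mem_image_of_mem _ hX, subset_compl_iff_disjoint_left.2 hXI⟩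

/-- Iterating the container lemma inside each container that still spans more than `B` edges:
after `q` rounds every container spans at most `B` edges, or at most the fraction
`(1 - codegreeConst s / s) ^ q` of the edges spanned by `P`. -/
theorem exists_containers_iterate {H : Finset (Finset V)} {s m : ℕ} {τ B : ℝ} (hτ : 0 < τ)
    (hs : 1 ≤ s) (hB : 0 ≤ B) (hH : ∀ E ∈ H, E.card = s) (hm : 4 * Fintype.card V * τ ≤ m)
    (hcodeg : ∀ T : Finset V, 2 ≤ T.card → (({E ∈ H | T ⊆ E} : Finset _).card : ℝ) ≤
      codegreeConst s * τ ^ (T.card - 1) * (B / Fintype.card V)) (q : ℕ) (P : Finset V) :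
    ∃ F : Finset (Finset V), F.card ≤ (Fintype.card V + 1) ^ (s * m * q) ∧
      (∀ C ∈ F, (({E ∈ H | E ⊆ C} : Finset _).card : ℝ) ≤
        max B ((1 - codegreeConst s / s) ^ q * ({E ∈ H | E ⊆ P} : Finset _).card)) ∧
      ∀ I ⊆ P, (∀ E ∈ H, ¬ E ⊆ I) → ∃ C ∈ F, I ⊆ C := by
  induction q generalizing P with
  | zero => exact ⟨{P}, by simp, by simp, fun I hI _ => ⟨P, mem_singleton_self P, hI⟩⟩
  | succ q ih =>
    by_cases hP : (({E ∈ H | E ⊆ P} : Finset _).card : ℝ) ≤ B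
    · refine ⟨{P}, by simpa using Nat.one_le_pow _ _ (Nat.succ_pos _), fun C hC => ?_,
        fun I hI _ => ⟨P, mem_singleton_self P, hI⟩⟩
      rw [mem_singleton.1 hC]
      exact le_max_of_le_left hP
    push Not at hP
    set H' : Finset (Finset V) := {E ∈ H | E ⊆ P} with hH'
    set δ := codegreeConst s / s with hδ
    have hδ1 : 0 ≤ 1 - δ := by
      have h1 : δ ≤ codegreeConst s := div_le_self (codegreeConst_pos s).le (Nat.one_le_cast.2 hs)
      linarith [codegreeConst_le s]
    obtain ⟨F, h1, h2, h3⟩ := exists_containers (H := H') hτ hs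
      (fun E hE => hH E (mem_filter.1 hE).1)
      (card_pos.1 (Nat.cast_pos.1 (hB.trans_lt hP))) hm
      (fun T hT => by
        have h4 : (({E ∈ H' | T ⊆ E} : Finset _).card : ℝ) ≤
            (({E ∈ H | T ⊆ E} : Finset _).card : ℝ) :=
          Nat.cast_le.2 (card_le_card (filter_subset_filter _ (filter_subset _ _)))
        refine (h4.trans (hcodeg T hT)).trans ?_
        have := (codegreeConst_pos s).le
        gcongr)
    choose G hG1 hG2 hG3 using fun C => ih (P ∩ C)
    refine ⟨F.biUnion G, ?_, ?_, ?_⟩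
    · calc (F.biUnion G).card
          ≤ F.card * (Fintype.card V + 1) ^ (s * m * q) :=
            card_biUnion_le_card_mul _ _ _ fun C _ => hG1 C
        _ ≤ (Fintype.card V + 1) ^ (s * m) * (Fintype.card V + 1) ^ (s * m * q) :=
            Nat.mul_le_mul_right _ h1
        _ = (Fintype.card V + 1) ^ (s * m * (q + 1)) := by ring
    · intro C' hC'
      obtain ⟨C, hC, hCC'⟩ := mem_biUnion.1 hC'
      refine (hG2 C C' hCC').trans (max_le_max le_rfl ?_)
      have h4 : ({E ∈ H | E ⊆ P ∩ C} : Finset _) = {E ∈ H' | E ⊆ C} := by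
        rw [hH', filter_filter]
        exact filter_congr fun E _ => subset_inter_iff
      rw [h4, pow_succ, mul_assoc]
      exact mul_le_mul_of_nonneg_left (h2 C hC) (pow_nonneg hδ1 q)
    · intro I hIP hI
      obtain ⟨C, hC, hIC⟩ := h3 I fun E hE => hI E (mem_filter.1 hE).1
      obtain ⟨C', hC', hIC'⟩ := hG3 C I (subset_inter hIP hIC) hI
      exact ⟨C', mem_biUnion.2 ⟨C, hC, hC'⟩, hIC'⟩

end Iteration

/-! ### The hypergraph of rainbow solutions -/

section RainbowHypergraph

variable {d r : ℕ} {A : Finset (Fin d → ℕ)}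

/-- A template encoded as the set of pairs (point, color in its palette). -/
def templateGraph (P : Template r A) : Finset ({x // x ∈ A} × Fin r) :=
  {p | p.2 ∈ P p.1}

/-- The template whose palettes are the fibers of a set of (point, color) pairs. -/
def templateOfGraph (E : Finset ({x // x ∈ A} × Fin r)) : Template r A :=
  fun x => {c | (x, c) ∈ E}

lemma templateOfGraph_templateGraph (P : Template r A) :
    templateOfGraph (templateGraph P) = P := by
  ext x c
  simp [templateOfGraph, templateGraph]

lemma templateGraph_templateOfGraph (E : Finset ({x // x ∈ A} × Fin r)) :
    templateGraph (templateOfGraph E) = E := by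
  ext p
  simp [templateOfGraph, templateGraph]

lemma templateGraph_subset_iff {P Q : Template r A} :
    templateGraph P ⊆ templateGraph Q ↔ IsSubtemplate P Q := by
  simp only [subset_iff, templateGraph, mem_filter, mem_univ, true_and, IsSubtemplate, Prod.forall]

open Classical in
/-- The hypergraph on (point, color) pairs whose edges are the rainbow solutions. -/
noncomputable def rainbowEdges (A : Finset (Fin d → ℕ)) (k h r : ℕ) :
    Finset (Finset ({x // x ∈ A} × Fin r)) :=
  {E | IsRainbowSolution k h (templateOfGraph E)}

lemma mem_rainbowEdges {k h : ℕ} {E : Finset ({x // x ∈ A} × Fin r)} :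
    E ∈ rainbowEdges A k h r ↔ IsRainbowSolution k h (templateOfGraph E) := by
  simp [rainbowEdges]

lemma rainbowCount_eq (k h : ℕ) (P : Template r A) :
    rainbowCount k h P = ({E ∈ rainbowEdges A k h r | E ⊆ templateGraph P} : Finset _).card := by
  have hinj : Function.Injective (templateGraph (r := r) (A := A)) :=
    Function.LeftInverse.injective templateOfGraph_templateGraph
  rw [rainbowCount, ← Set.ncard_image_of_injective _ hinj, ← Set.ncard_coe_finset]
  congr 1
  ext E
  simp only [Set.mem_image, Set.mem_ofPred_eq, coe_filter, mem_rainbowEdges]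
  constructor
  · rintro ⟨Q, ⟨h1, h2⟩, rfl⟩
    rw [templateOfGraph_templateGraph]
    exact ⟨h2, templateGraph_subset_iff.2 h1⟩
  · rintro ⟨h1, h2⟩
    refine ⟨templateOfGraph E, ⟨?_, h1⟩, templateGraph_templateOfGraph E⟩
    rw [← templateGraph_subset_iff, templateGraph_templateOfGraph]
    exact h2

lemma RainbowFree.not_subset {k h : ℕ} {P : Template r A} (hP : RainbowFree k h P)
    (E : Finset ({x // x ∈ A} × Fin r)) (hE : E ∈ rainbowEdges A k h r) :
    ¬ E ⊆ templateGraph P := fun hsub =>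
  hP ⟨templateOfGraph E, by
    rwa [← templateGraph_subset_iff, templateGraph_templateOfGraph], mem_rainbowEdges.1 hE⟩

lemma exists_param_of_mem_rainbowEdges {k h : ℕ} {E : Finset ({x // x ∈ A} × Fin r)}
    (hE : E ∈ rainbowEdges A k h r) :
    ∃ φ : Fin k × Fin h → {x // x ∈ A} × Fin r, Function.Injective φ ∧
      IsBSolution (fun ℓ i => (φ (ℓ, i)).1) ∧ univ.image φ = E := by
  obtain ⟨x, hx, hcard, hempty, hinj⟩ := mem_rainbowEdges.1 hE
  choose c hc using fun ℓ i => card_eq_one.1 (hcard ℓ i)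
  refine ⟨fun p => (x p.1 p.2, c p.1 p.2), fun p q hpq => hinj ?_, hx, ?_⟩
  · have h2 : c p.1 p.2 = c q.1 q.2 := congrArg Prod.snd hpq
    simp only [hc, h2]
  · ext ⟨y, b⟩
    have hmem : (y, b) ∈ E ↔ b ∈ templateOfGraph E y := by simp [templateOfGraph]
    rw [hmem]
    constructor
    · intro hy
      obtain ⟨p, -, hp⟩ := mem_image.1 hy
      obtain ⟨rfl, rfl⟩ := Prod.mk.inj hp
      rw [hc]
      exact mem_singleton_self _
    · intro hb
      by_cases hy : ∀ ℓ i, y ≠ x ℓ i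
      · rw [hempty y hy] at hb
        exact absurd hb (notMem_empty b)
      · push Not at hy
        obtain ⟨ℓ, i, rfl⟩ := hy
        rw [hc, mem_singleton] at hb
        exact mem_image.2 ⟨(ℓ, i), mem_univ _, by rw [hb]⟩

lemma card_of_mem_rainbowEdges {k h : ℕ} {E : Finset ({x // x ∈ A} × Fin r)}
    (hE : E ∈ rainbowEdges A k h r) : E.card = k * h := by
  obtain ⟨φ, hφ, -, rfl⟩ := exists_param_of_mem_rainbowEdges hE
  rw [card_image_of_injective _ hφ, card_univ, Fintype.card_prod, Fintype.card_fin,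
    Fintype.card_fin]

/-- If the positions in `Q` are prescribed in a solution, then there is a set `D` of further
positions whose values follow from all the others: one free position in each group that is not
filled by `Q`, except that, if no group is filled, one group has to be spared to fix the common
sum. Every group filled by `Q` uses up `h` elements of `Q`. -/
lemma exists_determined_positions {k h : ℕ} (hk : 0 < k) (hh : 0 < h)
    (Q : Finset (Fin k × Fin h)) :
    ∃ D : Finset (Fin k × Fin h), Disjoint D Q ∧ k ≤ D.card + max 1 (Q.card / h) ∧
      ∀ x y : Fin k → Fin h → {x // x ∈ A}, IsBSolution x → IsBSolution y →
        (∀ ℓ i, (ℓ, i) ∉ D → x ℓ i = y ℓ i) → x = y := by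
  classical
  set full : Finset (Fin k) := {ℓ | ∀ i, (ℓ, i) ∈ Q} with hfull
  obtain ⟨ℓ₀, hℓ₀⟩ : ∃ ℓ₀ : Fin k, (insert ℓ₀ full).card ≤ max 1 (Q.card / h) := by
    rcases full.eq_empty_or_nonempty with he | ⟨ℓ₀, hmem⟩
    · exact ⟨⟨0, hk⟩, by simp [he]⟩
    · refine ⟨ℓ₀, le_max_of_le_right ?_⟩
      rw [insert_eq_of_mem hmem, Nat.le_div_iff_mul_le hh]
      calc full.card * h = (full ×ˢ (univ : Finset (Fin h))).card := by simp
        _ ≤ Q.card := card_le_card fun p hp => by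
          have h1 := (mem_product.1 hp).1
          exact (mem_filter.1 h1).2 p.2
  have hfree : ∀ ℓ, ℓ ∉ full → ∃ i, (ℓ, i) ∉ Q := fun ℓ hℓ => by
    simpa [hfull] using hℓ
  have : Nonempty (Fin h) := ⟨⟨0, hh⟩⟩
  choose! g hg using hfree
  refine ⟨((insert ℓ₀ full)ᶜ).image fun ℓ => (ℓ, g ℓ), ?_, ?_, ?_⟩
  · rw [disjoint_left]
    rintro p hp
    obtain ⟨ℓ, hℓ, rfl⟩ := mem_image.1 hp
    exact hg ℓ fun h1 => mem_compl.1 hℓ (mem_insert_of_mem h1)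
  · rw [card_image_of_injective _ fun a b hab => congrArg Prod.fst hab, card_compl,
      Fintype.card_fin]
    omega
  · intro x y hx hy hxy
    have hD : ∀ ℓ i, i ≠ g ℓ ∨ ℓ = ℓ₀ → x ℓ i = y ℓ i := by
      intro ℓ i hi
      refine hxy ℓ i fun hmem => ?_
      obtain ⟨ℓ', hℓ', heq⟩ := mem_image.1 hmem
      obtain ⟨rfl, rfl⟩ := Prod.mk.inj heq
      rcases hi with hi | rfl
      · exact hi rfl
      · exact mem_compl.1 hℓ' (mem_insert_self _ _)
    have hsum : ∀ ℓ, ∑ i, (x ℓ i : Fin d → ℕ) = ∑ i, (y ℓ i : Fin d → ℕ) := fun ℓ => by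
      rw [hx ℓ ℓ₀, hy ℓ ℓ₀]
      exact sum_congr rfl fun i _ => by rw [hD ℓ₀ i (Or.inr rfl)]
    funext ℓ i
    by_cases hi : i = g ℓ
    · have h1 := hsum ℓ
      rw [← add_sum_erase _ _ (mem_univ i), ← add_sum_erase _ _ (mem_univ i),
        sum_congr rfl (g := fun j => (y ℓ j : Fin d → ℕ)) fun j hj => by
          rw [hD ℓ j (Or.inl (hi ▸ ne_of_mem_erase hj))]] at h1
      exact Subtype.ext (add_right_cancel h1)
    · exact hD ℓ i (Or.inl hi)

/-- The number of colored solutions with prescribed values at an injective family of `|T|`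
positions. -/
lemma card_param_mul_le {k h : ℕ} (hk : 0 < k) (hh : 0 < h) (hA : A.Nonempty)
    (T : Finset ({x // x ∈ A} × Fin r)) (ψ : {t // t ∈ T} → Fin k × Fin h)
    (S : Finset (Fin k × Fin h → {x // x ∈ A} × Fin r))
    (hS : ∀ φ ∈ S, IsBSolution (fun ℓ i => (φ (ℓ, i)).1) ∧ ∀ t, φ (ψ t) = t) :
    S.card * A.card ^ (T.card + k) ≤
      r ^ (k * h) * A.card ^ (k * h + max 1 (T.card / h)) := by
  classical
  rcases S.eq_empty_or_nonempty with rfl | ⟨φ₀, hφ₀⟩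
  · simp
  have hψ : Function.Injective ψ := fun a b hab =>
    Subtype.ext (by rw [← (hS φ₀ hφ₀).2 a, ← (hS φ₀ hφ₀).2 b, hab])
  set Q : Finset (Fin k × Fin h) := univ.image ψ with hQ
  have hQcard : Q.card = T.card := by
    rw [hQ, card_image_of_injective _ hψ, card_univ, Fintype.card_coe]
  obtain ⟨D, hDQ, hDcard, hD⟩ := exists_determined_positions (A := A) hk hh Q
  rw [hQcard] at hDcard
  -- Outside `D ∪ Q` the points are arbitrary, and all colors are arbitrary.
  have hcount : S.card ≤ A.card ^ (k * h - (D ∪ Q).card) * r ^ (k * h) := by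
    have h1 : S.card ≤ Fintype.card (({p // p ∈ (D ∪ Q)ᶜ} → {x // x ∈ A}) ×
        (Fin k × Fin h → Fin r)) := by
      rw [← card_univ]
      refine card_le_card_of_injOn (fun φ => (fun p => (φ p).1, fun p => (φ p).2))
        (fun _ _ => mem_univ _) fun φ hφ φ' hφ' heq => ?_
      obtain ⟨h2, h3⟩ := Prod.mk.inj heq
      have h4 := hD _ _ (hS φ hφ).1 (hS φ' hφ').1 fun ℓ i hi => by
        by_cases hiQ : (ℓ, i) ∈ Q
        · obtain ⟨t, -, ht⟩ := mem_image.1 hiQ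
          rw [← ht, (hS φ hφ).2 t, (hS φ' hφ').2 t]
        · exact congrFun h2 ⟨(ℓ, i), by simp [hi, hiQ]⟩
      funext p
      exact Prod.ext (congrFun (congrFun h4 p.1) p.2) (congrFun h3 p)
    simpa only [Fintype.card_prod, Fintype.card_fun, Fintype.card_coe, card_compl,
      Fintype.card_fin] using h1
  have hDQcard : (D ∪ Q).card = D.card + T.card := by
    rw [card_union_of_disjoint hDQ, hQcard]
  have hle : D.card + T.card ≤ k * h := by
    rw [← hDQcard]
    simpa using card_le_univ (D ∪ Q)
  calc S.card * A.card ^ (T.card + k)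
      ≤ A.card ^ (k * h - (D ∪ Q).card) * r ^ (k * h) * A.card ^ (T.card + k) :=
        Nat.mul_le_mul_right _ hcount
    _ = r ^ (k * h) * A.card ^ (k * h - (D.card + T.card) + (T.card + k)) := by
        rw [hDQcard, pow_add]; ring
    _ ≤ r ^ (k * h) * A.card ^ (k * h + max 1 (T.card / h)) :=
        Nat.mul_le_mul_left _ (Nat.pow_le_pow_right hA.card_pos (by omega))

/-- The number of rainbow solutions containing a given set `T` of (point, color) pairs. The term
`|T| / h` bounds the number of groups of the equation that `T` can fill. -/
lemma codegree_rainbowEdges_mul_le {k h : ℕ} (hk : 0 < k) (hh : 0 < h) (hA : A.Nonempty)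
    (T : Finset ({x // x ∈ A} × Fin r)) (hT : T.card ≤ k * h) :
    ({E ∈ rainbowEdges A k h r | T ⊆ E} : Finset _).card * A.card ^ (T.card + k) ≤
      (k * h) ^ (k * h) * r ^ (k * h) * A.card ^ (k * h + max 1 (T.card / h)) := by
  classical
  set S : ({t // t ∈ T} → Fin k × Fin h) → Finset (Fin k × Fin h → {x // x ∈ A} × Fin r) :=
    fun ψ => {φ | IsBSolution (fun ℓ i => (φ (ℓ, i)).1) ∧ ∀ t, φ (ψ t) = t} with hS
  have h1 : ({E ∈ rainbowEdges A k h r | T ⊆ E} : Finset _) ⊆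
      (univ.biUnion S).image fun φ => univ.image φ := by
    intro E hE
    obtain ⟨hE, hTE⟩ := mem_filter.1 hE
    obtain ⟨φ, -, hφ, rfl⟩ := exists_param_of_mem_rainbowEdges hE
    have h2 : ∀ t : {t // t ∈ T}, ∃ p, φ p = t := fun t => by
      simpa using hTE t.2
    choose ψ hψ using h2
    exact mem_image_of_mem _ (mem_biUnion.2 ⟨ψ, mem_univ ψ, mem_filter.2 ⟨mem_univ φ, hφ, hψ⟩⟩)
  calc ({E ∈ rainbowEdges A k h r | T ⊆ E} : Finset _).card * A.card ^ (T.card + k)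
      ≤ (∑ ψ, (S ψ).card) * A.card ^ (T.card + k) :=
        Nat.mul_le_mul_right _ ((card_le_card h1).trans (card_image_le.trans card_biUnion_le))
    _ = ∑ ψ, (S ψ).card * A.card ^ (T.card + k) := sum_mul _ _ _
    _ ≤ ∑ _ψ : {t // t ∈ T} → Fin k × Fin h,
          r ^ (k * h) * A.card ^ (k * h + max 1 (T.card / h)) :=
        sum_le_sum fun ψ _ => card_param_mul_le hk hh hA T ψ (S ψ) fun φ hφ =>
          (mem_filter.1 hφ).2
    _ = (k * h) ^ T.card * (r ^ (k * h) * A.card ^ (k * h + max 1 (T.card / h))) := by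
        simp
    _ ≤ (k * h) ^ (k * h) * (r ^ (k * h) * A.card ^ (k * h + max 1 (T.card / h))) :=
        Nat.mul_le_mul_right _ (Nat.pow_le_pow_right (Nat.mul_pos hk hh) hT)
    _ = (k * h) ^ (k * h) * r ^ (k * h) * A.card ^ (k * h + max 1 (T.card / h)) := by ring

end RainbowHypergraph

/-! ### Estimates -/

section Estimates

/-- The difference of the two sides is, up to the factor `d / (k * h - 1)`, the exponent of `n` in
the codegree condition. It is a positive integer for `l < k * h`, whereas for `l = k * h` the
powers of `n` cancel. -/
lemma codegree_exponent_pos {k h l : ℕ} (hk : 2 ≤ k) (hh : 2 ≤ h) (hl : 2 ≤ l) (hlt : l < k * h) :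
    (((max 1 (l / h) : ℕ) : ℝ) - 1) * (k * h - 1) + 1 ≤ (l - 1) * (k - 1) := by
  have key : ((max 1 (l / h) : ℕ) - 1 : ℤ) * (k * h - 1) + 1 ≤ (l - 1) * (k - 1) := by
    rcases le_total (l / h) 1 with h1 | h1
    · rw [max_eq_left h1]
      push_cast
      nlinarith
    · rw [max_eq_right h1]
      have h2 : l / h < k := Nat.div_lt_of_lt_mul (by rwa [mul_comm])
      have h3 : l / h * h ≤ l := Nat.div_mul_le_self l h
      generalize l / h = j at *
      zify at *
      have h4 : 1 ≤ ((k : ℤ) - j) * (h - 1) := by nlinarith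
      have h5 : ((j : ℤ) * h - 1) * (k - 1) ≤ (l - 1) * (k - 1) :=
        mul_le_mul_of_nonneg_right (by linarith) (by linarith)
      linarith [show ((j : ℤ) * h - 1) * (k - 1) = (j - 1) * (k * h - 1) + (k - j) * (h - 1) by ring]
  exact_mod_cast key

/-- The codegree condition of the container lemma for the hypergraph of rainbow solutions, with
`t ^ 2` in the role of `log n` and `q * t ^ 15` in that of `τ`. -/
lemma codegree_condition {d k h l : ℕ} {n t q a C : ℝ} (hd : 1 ≤ d) (hk : 2 ≤ k) (hh : 2 ≤ h)
    (hl : 2 ≤ l) (hle : l ≤ k * h) (hn : 1 ≤ n) (ht : 1 ≤ t) (hC : C ≤ t)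
    (hq : q = n ^ (-(((k : ℝ) * ((h : ℝ) - 1)) / ((k : ℝ) * (h : ℝ) - 1) * (d : ℝ))))
    (ha : n ^ d / t ^ 2 ≤ a)
    (hCn : C * t ^ (10 * (k * h)) ≤ n ^ (1 / ((k : ℝ) * h - 1))) :
    C * t ^ (10 * (k * h)) ≤ (q * t ^ 15) ^ (l - 1) * a ^ (l - max 1 (l / h)) := by
  have hn0 : 0 < n := by linarith
  have ht0 : 0 < t := by linarith
  have hq0 : 0 < q := hq ▸ Real.rpow_pos_of_pos hn0 _
  have hkR : (2 : ℝ) ≤ k := by exact_mod_cast hk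
  have hhR : (2 : ℝ) ≤ h := by exact_mod_cast hh
  have hs : (0 : ℝ) < (k : ℝ) * h - 1 := by nlinarith
  have hkh : k * 2 ≤ k * h := Nat.mul_le_mul_left k hh
  set j := max 1 (l / h) with hj
  have hj1 : 1 ≤ j := le_max_left _ _
  have hjl : j ≤ l := max_le (by omega) (Nat.div_le_self l h)
  -- Split off the powers of `t`.
  have hexp : 15 * (l - 1) = (15 * (l - 1) - 2 * (l - j)) + 2 * (l - j) := by omega
  have hlow : q ^ (l - 1) * (n ^ d) ^ (l - j) * t ^ (15 * (l - 1) - 2 * (l - j)) ≤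
      (q * t ^ 15) ^ (l - 1) * a ^ (l - j) := by
    have h1 : (n ^ d / t ^ 2) ^ (l - j) ≤ a ^ (l - j) :=
      pow_le_pow_left₀ (by positivity) ha _
    refine le_trans (le_of_eq ?_) (mul_le_mul_of_nonneg_left h1 (by positivity))
    rw [mul_pow, ← pow_mul t 15, hexp, pow_add, div_pow, ← pow_mul t 2, ← hexp]
    field_simp
  have hn_pow : q ^ (l - 1) * (n ^ d) ^ (l - j) =
      n ^ ((d : ℝ) * ((((l : ℝ) - 1) * (k - 1) - ((j : ℝ) - 1) * (k * h - 1)) / (k * h - 1))) := by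
    rw [hq, ← Real.rpow_natCast, ← Real.rpow_mul hn0.le, ← pow_mul, ← Real.rpow_natCast n,
      ← Real.rpow_add hn0]
    congr 1
    push_cast [Nat.cast_sub hjl, Nat.cast_sub (show 1 ≤ l by omega)]
    field_simp
    ring
  refine le_trans ?_ hlow
  rw [hn_pow]
  rcases hle.eq_or_lt with heq | hlt
  · have hjk : j = k := by
      rw [hj, heq, Nat.mul_div_cancel _ (by omega), max_eq_right (by omega)]
    have h1 : (d : ℝ) * ((((l : ℝ) - 1) * (k - 1) - ((j : ℝ) - 1) * (k * h - 1)) / (k * h - 1)) = 0 := by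
      rw [hjk, heq]; push_cast; ring
    rw [h1, Real.rpow_zero, one_mul]
    calc C * t ^ (10 * (k * h)) ≤ t * t ^ (10 * (k * h)) :=
          mul_le_mul_of_nonneg_right hC (by positivity)
      _ = t ^ (10 * (k * h) + 1) := by ring
      _ ≤ t ^ (15 * (l - 1) - 2 * (l - j)) := pow_le_pow_right₀ ht (by omega)
  · have h1 : n ^ (1 / ((k : ℝ) * h - 1)) ≤
        n ^ ((d : ℝ) * ((((l : ℝ) - 1) * (k - 1) - ((j : ℝ) - 1) * (k * h - 1)) / (k * h - 1))) := by
      refine Real.rpow_le_rpow_of_exponent_le hn ?_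
      have h2 : ((j : ℝ) - 1) * (k * h - 1) + 1 ≤ ((l : ℝ) - 1) * (k - 1) :=
        codegree_exponent_pos hk hh hl hlt
      have h3 : 1 / ((k : ℝ) * h - 1) ≤
          (((l : ℝ) - 1) * (k - 1) - ((j : ℝ) - 1) * (k * h - 1)) / (k * h - 1) := by
        gcongr; linarith
      have h4 : (1 : ℝ) ≤ d := by exact_mod_cast hd
      have h5 : 0 < 1 / ((k : ℝ) * h - 1) := by positivity
      nlinarith
    refine (hCn.trans h1).trans (le_mul_of_one_le_right (Real.rpow_nonneg hn0.le _) ?_)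
    exact one_le_pow₀ ht

/-- The number of rounds after which a hypergraph with at most `x ^ s` edges has no edges left, if
each round keeps at most the fraction `1 - δ` of them. -/
lemma exists_rounds {δ x : ℝ} (s : ℕ) (hδ : 0 < δ) (hδ1 : δ ≤ 1) (hx : 1 ≤ x) :
    ∃ Q : ℕ, (1 - δ) ^ Q * x ^ s < 1 ∧ (Q : ℝ) ≤ s * Real.log x / δ + 2 := by
  have hlog : 0 ≤ Real.log x := Real.log_nonneg hx
  refine ⟨⌈s * Real.log x / δ⌉₊ + 1, ?_, ?_⟩
  · set Q := ⌈s * Real.log x / δ⌉₊ + 1 with hQ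
    have h1 : s * Real.log x / δ < Q := by
      have := Nat.le_ceil (s * Real.log x / δ)
      rw [hQ]; push_cast; linarith
    rw [div_lt_iff₀ hδ] at h1
    have h2 : (1 - δ) ^ Q ≤ Real.exp (-(Q * δ)) := by
      calc (1 - δ) ^ Q ≤ Real.exp (-δ) ^ Q :=
            pow_le_pow_left₀ (by linarith) (Real.one_sub_le_exp_neg δ) Q
        _ = Real.exp (-(Q * δ)) := by rw [← Real.exp_nat_mul]; ring_nf
    have h3 : x ^ s = Real.exp (s * Real.log x) := by
      rw [Real.exp_nat_mul, Real.exp_log (by linarith)]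
    calc (1 - δ) ^ Q * x ^ s ≤ Real.exp (-(Q * δ)) * Real.exp (s * Real.log x) := by
          rw [h3]; exact mul_le_mul_of_nonneg_right h2 (Real.exp_pos _).le
      _ = Real.exp (s * Real.log x - Q * δ) := by rw [← Real.exp_add]; ring_nf
      _ < 1 := by rw [Real.exp_lt_one_iff]; linarith
  · have := Nat.ceil_lt_add_one (a := s * Real.log x / δ) (by positivity)
    push_cast; linarith

lemma eventually_mul_sqrt_logb_pow_le (C b : ℝ) (p : ℕ) (hb : 0 < b) :
    ∀ᶠ n : ℕ in Filter.atTop, C * √(Real.logb 2 n) ^ (2 * p) ≤ (n : ℝ) ^ b := by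
  have h1 : (fun x : ℝ => C / Real.log 2 ^ p * Real.log x ^ (p : ℝ)) =o[Filter.atTop]
      fun x => x ^ b :=
    (isLittleO_log_rpow_rpow_atTop p hb).const_mul_left _
  have h2 := (h1.bound one_pos).and (Filter.eventually_ge_atTop 1)
  filter_upwards [tendsto_natCast_atTop_atTop.eventually h2] with n ⟨hn, hn1⟩
  rw [one_mul, Real.norm_of_nonneg (Real.rpow_nonneg (by linarith) b), Real.rpow_natCast] at hn
  have h3 : 0 ≤ Real.logb 2 n := Real.logb_nonneg one_lt_two hn1
  rw [pow_mul, Real.sq_sqrt h3, Real.logb, div_pow]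
  refine le_trans (le_of_eq ?_) ((Real.le_norm_self _).trans hn)
  ring

lemma tendsto_sqrt_logb_atTop :
    Filter.Tendsto (fun n : ℕ => √(Real.logb 2 n)) Filter.atTop Filter.atTop :=
  Real.tendsto_sqrt_atTop.comp
    ((Real.tendsto_logb_atTop one_lt_two).comp tendsto_natCast_atTop_atTop)

end Estimates

/-! ### The container family for templates -/

section Assembly

lemma card_grid (n d : ℕ) : (grid n d).card = n ^ d := by
  simp [grid]

/-- The codegree hypothesis of the iterated container lemma, for edge bound
`B = |A| ^ (k * (h - 1) + 1) / t ^ (10 * k * h)` with `t ^ 2` in the role of `log n`. -/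
lemma codegree_rainbowEdges_le {d k h r : ℕ} {A : Finset (Fin d → ℕ)} {n t q : ℝ}
    (hd : 1 ≤ d) (hk : 2 ≤ k) (hh : 2 ≤ h) (hr : 1 ≤ r) (hn : 1 ≤ n) (ht : 1 ≤ t)
    (hA : A.Nonempty) {K C : ℝ} (hK : 0 < K)
    (hC : C = ((k * h : ℕ) : ℝ) ^ (k * h) * (r : ℝ) ^ (k * h) * r / K) (hCt : C ≤ t)
    (hq : q = n ^ (-(((k : ℝ) * ((h : ℝ) - 1)) / ((k : ℝ) * (h : ℝ) - 1) * (d : ℝ))))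
    (ha : n ^ d / t ^ 2 ≤ A.card)
    (hCn : C * t ^ (10 * (k * h)) ≤ n ^ (1 / ((k : ℝ) * h - 1)))
    (T : Finset ({x // x ∈ A} × Fin r)) (hT : 2 ≤ T.card) :
    (({E ∈ rainbowEdges A k h r | T ⊆ E} : Finset _).card : ℝ) ≤
      K * (q * t ^ 15) ^ (T.card - 1) *
        (((A.card : ℝ) ^ (k * (h - 1) + 1) / t ^ (10 * (k * h))) /
          Fintype.card ({x // x ∈ A} × Fin r)) := by
  have hn0 : 0 < n := by linarith
  have ht0 : 0 < t := by linarith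
  have hq0 : 0 < q := hq ▸ Real.rpow_pos_of_pos hn0 _
  have ha0 : (0 : ℝ) < A.card := Nat.cast_pos.2 hA.card_pos
  have hr0 : (0 : ℝ) < r := Nat.cast_pos.2 hr
  rw [Fintype.card_prod, Fintype.card_coe, Fintype.card_fin]
  push_cast
  by_cases hle : T.card ≤ k * h
  swap
  · have h0 : ({E ∈ rainbowEdges A k h r | T ⊆ E} : Finset _) = ∅ :=
      filter_eq_empty_iff.2 fun E hE hTE => hle <| by
        rw [← card_of_mem_rainbowEdges hE]
        exact card_le_card hTE
    rw [h0, card_empty, Nat.cast_zero]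
    positivity
  have h1 : (({E ∈ rainbowEdges A k h r | T ⊆ E} : Finset _).card : ℝ) *
      (A.card : ℝ) ^ (T.card + k) ≤ ((k * h : ℕ) : ℝ) ^ (k * h) * (r : ℝ) ^ (k * h) *
        (A.card : ℝ) ^ (k * h + max 1 (T.card / h)) := by
    exact_mod_cast codegree_rainbowEdges_mul_le (by omega) (by omega) hA T hle
  have h2 := codegree_condition hd hk hh hT hle hn ht hCt hq ha hCn
  set l := T.card
  set j := max 1 (l / h) with hj
  have hjl : j ≤ l := max_le (by omega) (Nat.div_le_self l h)
  set a : ℝ := (A.card : ℝ)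
  have hpow : a ^ (k * (h - 1) + 1) * a ^ (l + k) = a * (a ^ (l - j) * a ^ (k * h + j)) := by
    obtain ⟨h', rfl⟩ : ∃ h', h = h' + 1 := ⟨h - 1, by omega⟩
    rw [← pow_add, ← pow_add, ← pow_succ', Nat.add_sub_cancel]
    congr 1
    have : k * (h' + 1) = k * h' + k := by ring
    omega
  refine le_of_mul_le_mul_right (h1.trans ?_) (pow_pos ha0 (l + k))
  have hCK : ((k * h : ℕ) : ℝ) ^ (k * h) * (r : ℝ) ^ (k * h) = C * K / r := by
    rw [hC]; field_simp
  rw [hCK]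
  calc C * K / r * a ^ (k * h + j)
      = (C * t ^ (10 * (k * h))) * (K / (r * t ^ (10 * (k * h))) * a ^ (k * h + j)) := by
        field_simp
    _ ≤ ((q * t ^ 15) ^ (l - 1) * a ^ (l - j)) *
          (K / (r * t ^ (10 * (k * h))) * a ^ (k * h + j)) :=
        mul_le_mul_of_nonneg_right h2
          (mul_nonneg (div_nonneg hK.le (by positivity)) (pow_nonneg ha0.le _))
    _ = K * (q * t ^ 15) ^ (l - 1) / (r * t ^ (10 * (k * h))) / a *
          (a * (a ^ (l - j) * a ^ (k * h + j))) := by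
        field_simp
    _ = K * (q * t ^ 15) ^ (l - 1) * (a ^ (k * (h - 1) + 1) / t ^ (10 * (k * h)) / (a * r)) *
          a ^ (l + k) := by
        rw [← hpow]
        field_simp

/-- The number of containers. Here `x` is one more than the number of vertices, `m` the number of
branching steps per level and `Q` the number of rounds. -/
lemma container_exponent_le {d s r m Q : ℕ} {n t q a δ x : ℝ} (hr : 1 ≤ r) (ht : 1 ≤ t)
    (hδ : 0 < δ) (hLt : Real.logb 2 n = t ^ 2)
    (hx : 1 ≤ x) (hxn : x ≤ n ^ (d + 1)) (hqa : 1 ≤ a * (q * t ^ 15))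
    (hm : (m : ℝ) ≤ 4 * (a * r) * (q * t ^ 15) + 1) (hQ : (Q : ℝ) ≤ s * Real.log x / δ + 2)
    (hC : s * (5 * r) * (s * (d + 1) / δ + 2) * (d + 1) ≤ t) :
    Real.logb 2 x * ((s * m * Q : ℕ) : ℝ) ≤ a * q * (t ^ 2) ^ 10 := by
  have ht0 : 0 < t := by linarith
  have hr1 : (1 : ℝ) ≤ r := by exact_mod_cast hr
  have hx2 : Real.logb 2 x ≤ (d + 1) * t ^ 2 := by
    calc Real.logb 2 x ≤ Real.logb 2 (n ^ (d + 1)) :=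
          Real.logb_le_logb_of_le one_lt_two (by linarith) hxn
      _ = (d + 1) * t ^ 2 := by rw [Real.logb_pow, hLt]; push_cast; ring
  have hx0 : 0 ≤ Real.logb 2 x := Real.logb_nonneg one_lt_two hx
  have hlog : Real.log x ≤ (d + 1) * t ^ 2 := by
    refine le_trans ?_ hx2
    rw [Real.logb, le_div_iff₀ (Real.log_pos one_lt_two)]
    exact mul_le_of_le_one_right (Real.log_nonneg hx)
      (by linarith [Real.log_two_lt_d9])
  have ht2 : 1 ≤ t ^ 2 := one_le_pow₀ ht
  have hQ2 : (Q : ℝ) ≤ (s * (d + 1) / δ + 2) * t ^ 2 := by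
    have h1 : s * Real.log x / δ ≤ s * ((d + 1) * t ^ 2) / δ := by gcongr
    have h2 : s * ((d + 1) * t ^ 2) / δ = s * (d + 1) / δ * t ^ 2 := by ring
    linarith
  have hm2 : (m : ℝ) ≤ 5 * r * (a * (q * t ^ 15)) := by nlinarith
  push_cast
  have haq : 0 ≤ a * (q * t ^ 15) := by linarith
  have haq' : 0 ≤ a * q := by
    have h1 : 0 < a * q * t ^ 15 := by linarith [mul_assoc a q (t ^ 15)]
    exact (pos_of_mul_pos_left h1 (by positivity)).le
  calc Real.logb 2 x * (s * m * Q)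
      ≤ ((d + 1) * t ^ 2) * (s * (5 * r * (a * (q * t ^ 15))) *
          ((s * (d + 1) / δ + 2) * t ^ 2)) := by
        gcongr
    _ = (s * (5 * r) * (s * (d + 1) / δ + 2) * (d + 1)) * (a * q * t ^ 19) := by ring
    _ ≤ t * (a * q * t ^ 19) := mul_le_mul_of_nonneg_right hC (by positivity)
    _ = a * q * (t ^ 2) ^ 10 := by ring

end Assembly

theorem theorem3 (d k h r : ℕ) (hd : 1 ≤ d) (hk : 2 ≤ k) (hh : 2 ≤ h) (hr : k * h ≤ r) :
    ∃ n₀ : ℕ, ∀ n : ℕ, n₀ ≤ n → ∀ A : Finset (Fin d → ℕ), A ⊆ grid n d →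
      (n : ℝ) ^ d / Real.logb 2 (n : ℝ) ≤ (A.card : ℝ) →
      ∃ C : Finset (Template r A),
        (∀ P : Template r A, RainbowFree k h P → ∃ Q ∈ C, IsSubtemplate P Q) ∧
        (∀ P ∈ C, (rainbowCount k h P : ℝ) ≤
          1 / Real.logb 2 (n : ℝ) ^ (5 * k * h) * (A.card : ℝ) ^ (k * (h - 1) + 1)) ∧
        (C.card : ℝ) ≤ (2 : ℝ) ^ ((A.card : ℝ) *
          (n : ℝ) ^ (-(((k : ℝ) * ((h : ℝ) - 1)) / ((k : ℝ) * (h : ℝ) - 1) * (d : ℝ))) *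
          Real.logb 2 (n : ℝ) ^ 10) := by
  classical
  have hkR : (2 : ℝ) ≤ k := by exact_mod_cast hk
  have hhR : (2 : ℝ) ≤ h := by exact_mod_cast hh
  have hs4 : 4 ≤ k * h := Nat.mul_le_mul hk hh
  have hsR : (0 : ℝ) < (k : ℝ) * h - 1 := by nlinarith
  set s := k * h with hs
  set K := codegreeConst s with hK
  have hK0 : 0 < K := codegreeConst_pos s
  set δ := K / s with hδ
  have hs0 : (0 : ℝ) < s := Nat.cast_pos.2 (by omega)
  have hδ0 : 0 < δ := div_pos hK0 hs0
  have hδ1 : δ ≤ 1 := by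
    have h1 : δ ≤ K := div_le_self hK0.le (by exact_mod_cast (by omega : 1 ≤ s))
    linarith [codegreeConst_le s]
  set C₁ : ℝ := (s : ℝ) ^ s * (r : ℝ) ^ s * r / K with hC₁
  set C₂ : ℝ := s * (5 * r) * (s * (d + 1) / δ + 2) * (d + 1) with hC₂
  obtain ⟨n₀, hn₀⟩ := Filter.eventually_atTop.1
    ((((tendsto_sqrt_logb_atTop.eventually_ge_atTop 1).and
      (tendsto_sqrt_logb_atTop.eventually_ge_atTop C₁)).and
      (tendsto_sqrt_logb_atTop.eventually_ge_atTop C₂)).and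
      ((eventually_mul_sqrt_logb_pow_le C₁ (1 / ((k : ℝ) * h - 1)) (5 * s) (by positivity)).and
        (Filter.eventually_ge_atTop (r + 1))))
  refine ⟨n₀, fun n hn A hAgrid hAcard => ?_⟩
  obtain ⟨⟨⟨ht1, htC₁⟩, htC₂⟩, hnC₁, hnr⟩ := hn₀ n hn
  set t : ℝ := √(Real.logb 2 n) with ht
  have hnR : (1 : ℝ) ≤ n := by exact_mod_cast (by omega : 1 ≤ n)
  have hn0 : (0 : ℝ) < n := by linarith
  have ht0 : 0 < t := by linarith
  have hLt : Real.logb 2 n = t ^ 2 :=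
    (Real.sq_sqrt (Real.logb_nonneg one_lt_two hnR)).symm
  rw [hLt] at hAcard ⊢
  set q : ℝ := (n : ℝ) ^ (-(((k : ℝ) * ((h : ℝ) - 1)) / ((k : ℝ) * (h : ℝ) - 1) * (d : ℝ))) with hq
  have hq0 : 0 < q := Real.rpow_pos_of_pos hn0 _
  have ha0 : (0 : ℝ) < A.card := lt_of_lt_of_le (by positivity) hAcard
  have hA : A.Nonempty := card_pos.1 (Nat.cast_pos.1 ha0)
  have hr1 : 1 ≤ r := by omega
  set V := {x // x ∈ A} × Fin r
  have hV : Fintype.card V = A.card * r := by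
    rw [Fintype.card_prod, Fintype.card_coe, Fintype.card_fin]
  set B : ℝ := (A.card : ℝ) ^ (k * (h - 1) + 1) / t ^ (10 * s) with hB
  have hB0 : 0 ≤ B := div_nonneg (pow_nonneg ha0.le _) (pow_nonneg ht0.le _)
  have hBeq : 1 / (t ^ 2) ^ (5 * k * h) * (A.card : ℝ) ^ (k * (h - 1) + 1) = B := by
    rw [hB, ← pow_mul, show 2 * (5 * k * h) = 10 * s by rw [hs]; ring]
    ring
  set τ : ℝ := q * t ^ 15 with hτ
  have hτ0 : 0 < τ := by positivity
  set m := ⌈4 * Fintype.card V * τ⌉₊ with hm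
  have hx1 : (1 : ℝ) ≤ Fintype.card V + 1 := by linarith [(Nat.cast_nonneg _ : (0 : ℝ) ≤ Fintype.card V)]
  obtain ⟨Q, hQ1, hQ2⟩ := exists_rounds s hδ0 hδ1 hx1
  obtain ⟨F, hF1, hF2, hF3⟩ := exists_containers_iterate (H := rainbowEdges A k h r) (s := s)
    (m := m) (τ := τ) (B := B) hτ0 (by omega) hB0 (fun E hE => card_of_mem_rainbowEdges hE)
    (Nat.le_ceil _)
    (codegree_rainbowEdges_le hd hk hh hr1 hnR ht1 hA hK0 hC₁ htC₁ hq hAcard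
      (by rw [show 10 * (k * h) = 2 * (5 * s) by rw [hs]; ring]; exact hnC₁)) Q univ
  refine ⟨F.image templateOfGraph, ?_, ?_, ?_⟩
  · intro P hP
    obtain ⟨C, hC, hPC⟩ := hF3 (templateGraph P) (subset_univ _) hP.not_subset
    refine ⟨templateOfGraph C, mem_image_of_mem _ hC, ?_⟩
    rwa [← templateGraph_subset_iff, templateGraph_templateOfGraph]
  · intro P hP
    obtain ⟨C, hC, rfl⟩ := mem_image.1 hP
    rw [hBeq, rainbowCount_eq, templateGraph_templateOfGraph]
    rcases le_max_iff.1 (hF2 C hC) with h1 | h1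
    · exact h1
    -- Otherwise fewer than one, hence no, edge survives all rounds.
    have h2 : (({E ∈ rainbowEdges A k h r | E ⊆ univ} : Finset _).card : ℝ) ≤
        ((Fintype.card V : ℝ) + 1) ^ s := by
      have h3 : ({E ∈ rainbowEdges A k h r | E ⊆ univ} : Finset _) ⊆
          powersetCard s (univ : Finset V) := fun E hE =>
        mem_powersetCard.2 ⟨subset_univ E, card_of_mem_rainbowEdges (mem_filter.1 hE).1⟩
      have h4 := (card_le_card h3).trans_eq (card_powersetCard s univ)
      have h5 : (Fintype.card V).choose s ≤ (Fintype.card V + 1) ^ s :=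
        (Nat.choose_le_pow _ _).trans (Nat.pow_le_pow_left (Nat.le_succ _) s)
      exact_mod_cast h4.trans h5
    have h3 : (({E ∈ rainbowEdges A k h r | E ⊆ C} : Finset _).card : ℝ) < 1 :=
      (h1.trans (mul_le_mul_of_nonneg_left h2 (pow_nonneg (by linarith) Q))).trans_lt hQ1
    have h4 : ({E ∈ rainbowEdges A k h r | E ⊆ C} : Finset _).card = 0 :=
      Nat.lt_one_iff.1 (by exact_mod_cast h3)
    rw [h4, Nat.cast_zero]
    exact hB0
  · have h1 : ((F.image templateOfGraph).card : ℝ) ≤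
        ((Fintype.card V : ℝ) + 1) ^ (s * m * Q) := by
      exact_mod_cast card_image_le.trans hF1
    have hxn : (Fintype.card V : ℝ) + 1 ≤ (n : ℝ) ^ (d + 1) := by
      have h2 : A.card ≤ n ^ d := (card_le_card hAgrid).trans_eq (card_grid n d)
      have h3 : Fintype.card V + 1 ≤ n ^ (d + 1) := by
        calc Fintype.card V + 1 ≤ n ^ d * r + n ^ d := by
              rw [hV]
              exact Nat.add_le_add (Nat.mul_le_mul_right r h2) (Nat.one_le_pow _ _ (by omega))
          _ = n ^ d * (r + 1) := by ring
          _ ≤ n ^ d * n := Nat.mul_le_mul_left _ hnr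
          _ = n ^ (d + 1) := (pow_succ n d).symm
      exact_mod_cast h3
    have hqa : 1 ≤ (A.card : ℝ) * (q * t ^ 15) := by
      have h2 : ((n : ℝ) ^ d)⁻¹ ≤ q := by
        rw [hq, ← Real.rpow_natCast, ← Real.rpow_neg hn0.le]
        refine Real.rpow_le_rpow_of_exponent_le hnR (neg_le_neg ?_)
        refine mul_le_of_le_one_left (Nat.cast_nonneg d) ?_
        rw [div_le_one hsR]
        linarith
      have hnd : 0 < (n : ℝ) ^ d := by positivity
      calc (1 : ℝ) ≤ t ^ 13 := one_le_pow₀ ht1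
        _ = (n : ℝ) ^ d / t ^ 2 * (((n : ℝ) ^ d)⁻¹ * t ^ 15) := by field_simp
        _ ≤ A.card * (q * t ^ 15) :=
            mul_le_mul hAcard (mul_le_mul_of_nonneg_right h2 (by positivity)) (by positivity) ha0.le
    have hexp := container_exponent_le (d := d) (s := s) (r := r) (m := m) (Q := Q) hr1 ht1 hδ0
      hLt hx1 hxn hqa (by
        refine (Nat.ceil_lt_add_one (by positivity)).le.trans_eq ?_
        rw [hV]; push_cast; ring) hQ2 htC₂
    refine h1.trans ?_
    rw [← Real.rpow_natCast]
    nth_rewrite 1 [← Real.rpow_logb two_pos (by norm_num) (by linarith : (0 : ℝ) < Fintype.card V + 1)]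
    rw [← Real.rpow_mul two_pos.le]
    exact Real.rpow_le_rpow_of_exponent_le one_le_two hexp
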